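/- Let $X$ be a nonempty (quasi-compact) Noetherian scheme and let $f\colon X\dashrightarrow X$ be a dominant rational self-map, i.e. an equivalence class of morphisms $\varphi\colon U\to X$ with dense image defined on dense open subschemes $U\subseteq X$, two of them being equivalent if they agree on a dense open subscheme. Let $g\colon D\to X$ be any map of sets, defined on a dense subset $D\subseteq X$, that is induced by $f$: every point of $D$ lies in the domain $U\subseteq D$ of some representative $\varphi$ of $f$ such that $g|_U=\varphi$ on points (so $D$ is open). For instance, $g$ may be the map on points of any representative of $f$ or, when $X$ is reduced and separated, the canonical map $X\setminus \mathrm{Ind}(f)\to X$ on the whole domain of definition of $f$. Put $\xi_0=X$ and $\xi_{n+1}=g^{-1}(\xi_n)$, so that $\xi_n$ is the set of points at which $g^n$ is defined. For a topology $\tau$ on $X$ define two entropies in $[-\infty,+\infty]$. (a) For a symmetric neighbourhood $\mathcal E$ of the diagonal in $(X,\tau)\times(X,\tau)$, let $R(n,\mathcal E)$ be the least cardinality of a set $F\subseteq \xi_n$ such that for every $y\in\xi_n$ there is $x\in F$ with $(g^i(x),g^i(y))\in\mathcal E$ for all $0\le i\le n$, and put $h_{\mathrm{ent}}(g,\tau)=\sup_{\mathcal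 E}\limsup_{n}\frac1n\log R(n,\mathcal E)$. (b) For a finite $\tau$-open cover $\mathfrak U$ of $X$, let $N(\mathfrak U_n)$ be the least number of sets of the form $\bigcap_{i=0}^{n-1}g^{-i}(U_i)$, $U_i\in\mathfrak U$, needed to cover $\bigcap_{i<n}\xi_i$, and put $h_{\mathrm{cov}}(g,\tau)=\sup_{\mathfrak U}\limsup_{n}\frac1n\log N(\mathfrak U_n)$. Let $\tau^{\mathrm{zar}}$ be the Zariski topology of $X$ and let $\tau^{\mathrm{con}}$ be its constructible topology, generated by the quasi-compact open sets and their complements (a compact Hausdorff topology). Then \[ h_{\mathrm{ent}}(g,\tau^{\mathrm{con}})=h_{\mathrm{cov}}(g,\tau^{\mathrm{con}})=0 \qquad\text{and}\qquad h_{\mathrm{cov}}(g,\tau^{\mathrm{zar}})=0 . \] In other words, the topological entropy of $f$ is zero for both the constructible and the Zariski topology. -/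

import Mathlib

open AlgebraicGeometry

universe u

/-! ### Partially defined self-maps and their topological entropy -/

namespace PartialDynamics

variable {α : Type u}

/-- The `n`-th iterate of a partially defined self-map: `f^n` is defined at `x` exactly when
`x, f x, …, f^(n-1) x` all lie in the domain of `f`. -/
def iter (f : α →. α) : ℕ → (α →. α)
  | 0 => PFun.id α
  | n + 1 => (iter f n).comp f

/-- The maximal admissible sequence of `f`: `ξ 0` is the whole space, and `ξ (n + 1)` is the
set of the points of the domain of `f` which `f` sends into `ξ n`. -/
def maxSeq (f : α →. α) : ℕ → Set α
  | 0 => Set.univ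
  | n + 1 => f.preimage (maxSeq f n)

/-- The maximal admissible sequence consists of the domains of the iterates. -/
theorem maxSeq_eq_dom_iter (f : α →. α) (n : ℕ) : maxSeq f n = (iter f n).Dom := by
  induction n with
  | zero => ext x; simp [maxSeq, iter, PFun.mem_dom]
  | succ n ih => rw [maxSeq, ih, iter, PFun.dom_comp]

/-- The points `y` at which `f^n` is defined and whose orbit up to time `n` is `E`-close to
that of `x`. -/
def dynBall (f : α →. α) (n : ℕ) (E : Set (α × α)) (x : α) : Set α :=
  {y ∈ maxSeq f n | ∀ i ≤ n, ∃ a ∈ iter f i x, ∃ b ∈ iter f i y, (a, b) ∈ E}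

/-- The least cardinality of a set of points at which `f^n` is defined such that the associated
dynamical balls cover all the points at which `f^n` is defined. -/
noncomputable def coveringNumber (f : α →. α) (n : ℕ) (E : Set (α × α)) : ℕ∞ :=
  ⨅ (F : Set α) (_ : F ⊆ maxSeq f n) (_ : maxSeq f n ⊆ ⋃ x ∈ F, dynBall f n E x), F.encard

/-- A symmetric entourage of the topology `τ`: a symmetric neighbourhood of the diagonal.
For a compact Hausdorff topology the neighbourhoods of the diagonal form the unique uniform
structure that induces it. -/
def IsSymmEntourage (τ : TopologicalSpace α) (E : Set (α × α)) : Prop :=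
  E ∈ nhdsSet (Set.diagonal α) ∧ Prod.swap ⁻¹' E = E

/-- The topological entropy of a partially continuous self-map of a compact Hausdorff space,
`sup_E limsup_n (1/n) log R(n, E)`, taken over the symmetric entourages `E`. It is `⊥` when some
iterate of `f` is nowhere defined. -/
noncomputable def entourageEntropy (τ : TopologicalSpace α) (f : α →. α) : EReal :=
  ⨆ (E : Set (α × α)) (_ : IsSymmEntourage τ E),
    ExpGrowth.expGrowthSup fun n : ℕ => (coveringNumber f n E : ENNReal)

/-- A finite cover of the space by open sets. -/
structure IsFiniteOpenCover (τ : TopologicalSpace α) (𝒰 : Set (Set α)) : Prop where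
  finite : 𝒰.Finite
  isOpen : ∀ U ∈ 𝒰, IsOpen U
  covers : ⋃₀ 𝒰 = Set.univ

/-- The join of `𝒰, f⁻¹ 𝒰, …, f^(-(n-1)) 𝒰`: its members are the sets
`U₀ ∩ f⁻¹ U₁ ∩ … ∩ f^(-(n-1)) U_(n-1)` with all `U_i` in `𝒰`. -/
def joinCover (f : α →. α) (𝒰 : Set (Set α)) (n : ℕ) : Set (Set α) :=
  {W | ∃ U : ℕ → Set α, (∀ i < n, U i ∈ 𝒰) ∧ W = ⋂ i < n, (iter f i).preimage (U i)}

/-- The least number of members of `joinCover f 𝒰 n` that cover the set of points at which all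
of `f^0, …, f^(n-1)` are defined (the whole space if `f` is everywhere defined). -/
noncomputable def coverComplexity (f : α →. α) (𝒰 : Set (Set α)) (n : ℕ) : ℕ∞ :=
  ⨅ (T : Set (Set α)) (_ : T ⊆ joinCover f 𝒰 n) (_ : (⋂ i < n, maxSeq f i) ⊆ ⋃₀ T), T.encard

/-- The topological entropy through open covers, `sup_𝒰 limsup_n (1/n) log N(𝒰_n)`, taken over
the finite open covers `𝒰`. -/
noncomputable def openCoverEntropy (τ : TopologicalSpace α) (f : α →. α) : EReal :=
  ⨆ (𝒰 : Set (Set α)) (_ : IsFiniteOpenCover τ 𝒰),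
    ExpGrowth.expGrowthSup fun n : ℕ => (coverComplexity f 𝒰 n : ENNReal)

end PartialDynamics

/-- The Zariski topology of a scheme. -/
abbrev zariskiTopology (X : Scheme.{u}) : TopologicalSpace X := inferInstance

/-! ### The point maps induced by a rational self-map -/

namespace RationalDynamics

variable {X : Scheme.{u}}

/-- The partially defined map on points underlying a morphism from a dense open subscheme. -/
noncomputable def pointMap (φ : X.PartialMap X) : X →. X :=
  fun x => ⟨x ∈ φ.domain, fun hx => φ.hom ⟨x, hx⟩⟩

/-- `g` is a partially defined map on points induced by the rational map `f`: it is densely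
defined, and around every point of its domain it is given by a representative of `f`.
No separation axiom is imposed on `X`. If `X` is reduced and separated, the largest such `g` is
the canonical map defined outside the indeterminacy locus of `f`; without separation, `f` may have
several maximal induced point maps. -/
def Induces (f : X ⤏ X) (g : X →. X) : Prop :=
  Dense g.Dom ∧ ∀ x ∈ g.Dom, ∃ φ : X.PartialMap X, φ.toRationalMap = f ∧ x ∈ φ.domain ∧
    ∀ y ∈ φ.domain, g y = pointMap φ y

/-- Every representative of a rational map induces a point map. -/
theorem induces_pointMap (φ : X.PartialMap X) : Induces φ.toRationalMap (pointMap φ) :=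
  ⟨φ.dense_domain, fun _ hx => ⟨φ, rfl, hx, fun _ _ => rfl⟩⟩

/-- On a reduced separated scheme, a rational map induces a point map defined on its whole domain
of definition. -/
theorem induces_pointMap_toPartialMap [IsReduced X] [X.IsSeparated] (f : X ⤏ X) :
    Induces f (pointMap f.toPartialMap) ∧
      (pointMap f.toPartialMap).Dom = (f.domain : Set X) := by
  refine ⟨?_, rfl⟩
  have h := induces_pointMap f.toPartialMap
  rwa [Scheme.RationalMap.toRationalMap_toPartialMap] at h

end RationalDynamics

/-! Only two properties of `g` matter: preimages of open sets are open, and no iterate has empty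
domain. The second gives entropy at least zero. For the upper bound, compactness of the
constructible topology reduces every entourage or finite open cover to finitely many Zariski closed
sets `Z`, so it suffices that the number of sets of visiting times to `Z` before `n` is
subexponential (`eventually_encard_pattern_le`).

If it were not, Sauer–Shelah would give shattered sets of times of positive density for arbitrarily
large `n`. Shattered sets are independent, and independence is hereditary and shift-invariant, so a
limit argument yields an infinite set of times all of whose finite subsets are independent
(`exists_infinite_of_frequently_dense`). This contradicts the descending chain condition on closed
sets (`exists_not_isIndependent`). The Zariski case follows because Zariski open covers are
constructible open covers. -/

/-! ### Hereditary shift-invariant families of finite sets of natural numbers -/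

section Families

open Finset Filter

/-- A finite set of density at least `δ` in `{0, …, n - 1}` has a point from which on all its
densities up to time `K` are at least `δ / 2`. -/
theorem exists_forall_le_card_window {n K : ℕ} {δ : ℝ} (S : Finset ℕ) (hS : S ⊆ range n)
    (hδ : δ * n ≤ #S) (hK : K < δ / 2 * n) :
    ∃ p, ∀ k ≤ K, δ / 2 * k ≤ #{i ∈ S | p ≤ i ∧ i < p + k} := by
  by_contra! h
  -- Otherwise each `p` starts a window of length at most `K` of density below `δ / 2`. Tiling `[p,
  -- n)` by such windows leaves a tail of length at most `K`; with `p = 0` this contradicts `hK`.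
  have key : ∀ m p, p ≤ n → n - p = m → (#{i ∈ S | p ≤ i} : ℝ) ≤ δ / 2 * m + K := by
    intro m
    induction m using Nat.strong_induction_on with
    | _ m ih =>
      intro p hp hm
      obtain ⟨k, hkK, hk⟩ := h p
      have hδ0 : 0 ≤ δ := by
        by_contra! h0
        have : δ / 2 * n ≤ 0 := mul_nonpos_of_nonpos_of_nonneg (by linarith) (by positivity)
        have : (0 : ℝ) ≤ K := by positivity
        linarith
      rcases le_or_gt m K with hmK | hmK
      · have h1 : #{i ∈ S | p ≤ i} ≤ m := by
          rw [← hm, ← Nat.card_Ico]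
          refine card_le_card fun i hi => ?_
          rw [mem_filter] at hi
          exact mem_Ico.2 ⟨hi.2, mem_range.1 (hS hi.1)⟩
        have h2 : (#{i ∈ S | p ≤ i} : ℝ) ≤ K := by exact_mod_cast h1.trans hmK
        have : 0 ≤ δ / 2 * m := by positivity
        linarith
      · have hk0 : 0 < k := by
          rcases Nat.eq_zero_or_pos k with rfl | h0
          · exact absurd hk (by simp)
          · exact h0
        have h1 := ih (m - k) (by omega) (p + k) (by omega) (by omega)
        have h2 : #{i ∈ S | p ≤ i} ≤ #{i ∈ S | p ≤ i ∧ i < p + k} + #{i ∈ S | p + k ≤ i} := by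
          refine (card_le_card fun i hi => ?_).trans (card_union_le _ _)
          simp only [mem_union, mem_filter] at hi ⊢
          have := hi.2
          have := hi.1
          rcases lt_or_ge i (p + k) with h | h <;> simp_all
        have h3 : (#{i ∈ S | p ≤ i} : ℝ) ≤
            #{i ∈ S | p ≤ i ∧ i < p + k} + #{i ∈ S | p + k ≤ i} := by exact_mod_cast h2
        have h4 : ((m - k : ℕ) : ℝ) = m - k := Nat.cast_sub (by omega)
        rw [h4] at h1
        linarith
  have := key n 0 (Nat.zero_le _) rfl
  simp at this
  linarith

/-- A hereditary, shift-invariant family of finite sets of natural numbers which has members of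
density at least `δ > 0` in arbitrarily long initial segments contains all the finite subsets of
some infinite set. -/
theorem exists_infinite_of_frequently_dense {P : Finset ℕ → Prop}
    (hmono : ∀ S T, S ⊆ T → P T → P S) (hshift : ∀ s S, P (S.map (addRightEmbedding s)) → P S)
    {δ : ℝ} (hδ : 0 < δ)
    (h : ∃ᶠ n : ℕ in atTop, ∃ S, P S ∧ S ⊆ range n ∧ δ * n ≤ #S) :
    ∃ T : Set ℕ, T.Infinite ∧ ∀ S : Finset ℕ, (S : Set ℕ) ⊆ T → P S := by
  have step : ∀ K : ℕ, ∃ S, P S ∧ ∀ k ≤ K, δ / 2 * k ≤ #{i ∈ S | i < k} := by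
    intro K
    have hlarge : ∀ᶠ n : ℕ in atTop, (K : ℝ) < δ / 2 * n :=
      (tendsto_natCast_atTop_atTop.const_mul_atTop (half_pos hδ)).eventually_gt_atTop _
    obtain ⟨n, ⟨S, hP, hSn, hS⟩, hn⟩ := (h.and_eventually hlarge).exists
    obtain ⟨p, hp⟩ := exists_forall_le_card_window S hSn hS hn
    -- The good window is moved to the origin, which shift invariance allows.
    refine ⟨{j ∈ range K | j + p ∈ S}, hshift p _ (hmono _ S ?_ hP), fun k hk => ?_⟩
    · intro i hi
      simp only [Finset.mem_map, mem_filter, addRightEmbedding_apply] at hi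
      obtain ⟨j, hj, rfl⟩ := hi
      exact hj.2
    · refine (hp k hk).trans ?_
      norm_cast
      refine card_le_card_of_injOn (fun i => i - p) (fun i hi => ?_) (fun i hi j hj hij => ?_)
      · simp only [coe_filter, Set.mem_ofPred_eq, mem_filter, mem_range] at hi ⊢
        rw [Nat.sub_add_cancel hi.2.1]
        exact ⟨⟨by omega, hi.1⟩, by omega⟩
      · simp only [coe_filter, Set.mem_ofPred_eq] at hi hj hij
        omega
  choose S hP hS using step
  -- `T` is the limit of the `S K` in the compact space of subsets of `ℕ`: on each finite set of
  -- times it agrees with `S K` for arbitrarily large `K`, so it inherits the lower density bounds.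
  let T : Set ℕ := {i | ∀ᶠ K in (hyperfilter ℕ : Filter ℕ), i ∈ S K}
  have hle : (hyperfilter ℕ : Filter ℕ) ≤ atTop := by
    simpa [Nat.cofinite_eq_atTop] using hyperfilter_le_cofinite (α := ℕ)
  have hagree : ∀ i, ∀ᶠ K in (hyperfilter ℕ : Filter ℕ), (i ∈ T ↔ i ∈ S K) := by
    intro i
    by_cases hi : i ∈ T
    · filter_upwards [hi] with K hK using by simp [hi, hK]
    · filter_upwards [Ultrafilter.eventually_not.2 hi] with K hK using by simp [hi, hK]
  refine ⟨T, fun hfin => ?_, fun F hF => ?_⟩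
  · obtain ⟨k, hk⟩ := exists_nat_gt (#hfin.toFinset / (δ / 2) : ℝ)
    rw [div_lt_iff₀ (half_pos hδ)] at hk
    have hev : ∀ᶠ K in (hyperfilter ℕ : Filter ℕ), ∀ i ∈ range k, (i ∈ T ↔ i ∈ S K) :=
      (eventually_all_finset _).2 fun i _ => hagree i
    obtain ⟨K, hK, hkK⟩ := (hev.and (hle (eventually_ge_atTop k))).exists
    have h1 : #{i ∈ S K | i < k} ≤ #hfin.toFinset := by
      refine card_le_card fun i hi => ?_
      rw [mem_filter] at hi
      exact hfin.mem_toFinset.2 ((hK i (mem_range.2 hi.2)).2 hi.1)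
    have h2 : (#{i ∈ S K | i < k} : ℝ) ≤ #hfin.toFinset := by exact_mod_cast h1
    have := hS K k hkK
    linarith
  · have hev : ∀ᶠ K in (hyperfilter ℕ : Filter ℕ), ∀ i ∈ F, i ∈ S K :=
      (eventually_all_finset _).2 fun i hi => hF hi
    obtain ⟨K, hK⟩ := hev.exists
    exact hmono F (S K) hK (hP K)

/-- The number of subsets of `{0, …, n - 1}` of cardinality at most `δ n` is at most
`t ^ (- δ n) * (1 + t) ^ n`. -/
theorem card_le_of_forall_card_le {n : ℕ} {δ t : ℝ} (ht : 0 < t) (ht1 : t ≤ 1)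
    (𝒜 : Finset (Finset ℕ)) (h𝒜 : ∀ S ∈ 𝒜, S ⊆ range n ∧ #S ≤ δ * n) :
    (#𝒜 : ℝ) ≤ Real.exp ((δ * Real.log t⁻¹ + t) * n) := by
  -- Chernoff-type bound: with weight `t ^ #S`, all subsets together weigh `(t + 1) ^ n`, and each
  -- member of `𝒜` weighs at least `t ^ (δ * n)`.
  have h1 : ∑ S ∈ 𝒜, t ^ #S ≤ (t + 1) ^ n := by
    calc ∑ S ∈ 𝒜, t ^ #S ≤ ∑ S ∈ (range n).powerset, t ^ #S :=
          sum_le_sum_of_subset_of_nonneg (fun S hS => mem_powerset.2 (h𝒜 S hS).1)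
            fun _ _ _ => by positivity
      _ = (t + 1) ^ n := by simpa using sum_pow_mul_eq_add_pow t 1 (range n)
  have h2 : #𝒜 * Real.exp (-(δ * n * Real.log t⁻¹)) ≤ ∑ S ∈ 𝒜, t ^ #S := by
    rw [← nsmul_eq_mul]
    refine card_nsmul_le_sum _ _ _ fun S hS => ?_
    rw [← Real.exp_log (pow_pos ht _), Real.log_pow, Real.log_inv, Real.exp_le_exp]
    have := Real.log_nonpos ht.le ht1
    nlinarith [(h𝒜 S hS).2]
  have h3 : (t + 1) ^ n ≤ Real.exp (t * n) := by
    rw [mul_comm, Real.exp_nat_mul]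
    exact pow_le_pow_left₀ (by linarith) (Real.add_one_le_exp t) n
  have h4 := h2.trans (h1.trans h3)
  rw [Real.exp_neg, ← div_eq_mul_inv, div_le_iff₀ (Real.exp_pos _), ← Real.exp_add] at h4
  exact h4.trans_eq (by ring_nf)

/-- Let `𝒜 n` be families of subsets of `{0, …, n - 1}` such that all the sets they shatter belong
to a hereditary, shift-invariant family which does not contain all the finite subsets of an infinite
set. Then the cardinality of `𝒜 n` grows subexponentially. -/
theorem eventually_card_le_exp {P : Finset ℕ → Prop}
    (hmono : ∀ S T, S ⊆ T → P T → P S) (hshift : ∀ s S, P (S.map (addRightEmbedding s)) → P S)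
    (hinf : ∀ T : Set ℕ, T.Infinite → ∃ S : Finset ℕ, (S : Set ℕ) ⊆ T ∧ ¬ P S)
    (𝒜 : ℕ → Finset (Finset ℕ)) (h𝒜 : ∀ n, ∀ S ∈ 𝒜 n, S ⊆ range n)
    (hP : ∀ n S, (𝒜 n).Shatters S → P S) {ε : ℝ} (hε : 0 < ε) :
    ∀ᶠ n : ℕ in atTop, (#(𝒜 n) : ℝ) ≤ Real.exp (ε * n) := by
  -- With `δ = (ε / 2) / log t⁻¹` the exponent `δ * log t⁻¹ + t` is at most `ε`.
  obtain ⟨t, ht, ht1, htε⟩ : ∃ t : ℝ, 0 < t ∧ t < 1 ∧ t ≤ ε / 2 :=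
    ⟨min (1 / 2) (ε / 2), by positivity, (min_le_left _ _).trans_lt (by norm_num), min_le_right _ _⟩
  have hlog : 0 < Real.log t⁻¹ := Real.log_pos ((one_lt_inv₀ ht).2 ht1)
  have hδ : 0 < ε / 2 / Real.log t⁻¹ := by positivity
  have hsmall : ¬ ∃ᶠ n : ℕ in atTop, ∃ S, P S ∧ S ⊆ range n ∧ ε / 2 / Real.log t⁻¹ * n ≤ #S := by
    intro h
    obtain ⟨T, hT, hTP⟩ := exists_infinite_of_frequently_dense hmono hshift hδ h
    obtain ⟨S, hST, hS⟩ := hinf T hT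
    exact hS (hTP S hST)
  filter_upwards [not_frequently.1 hsmall] with n hn
  -- Sauer–Shelah in Pajor's form: a family shatters at least as many sets as it has members.
  have h1 : (#(𝒜 n) : ℝ) ≤ #(𝒜 n).shatterer := by exact_mod_cast card_le_card_shatterer _
  refine h1.trans ((card_le_of_forall_card_le (δ := ε / 2 / Real.log t⁻¹) (n := n) ht ht1.le _
    fun S hS => ?_).trans ?_)
  · rw [mem_shatterer] at hS
    obtain ⟨U, hU, hSU⟩ := hS.exists_superset
    have hSn := hSU.trans (h𝒜 n U hU)
    refine ⟨hSn, ?_⟩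
    by_contra! hlt
    exact hn ⟨S, hP n S hS, hSn, hlt.le⟩
  · rw [div_mul_cancel₀ _ hlog.ne', Real.exp_le_exp]
    gcongr
    linarith

end Families

/-! ### Itineraries of partially defined maps of Noetherian spaces -/

namespace PartialDynamics

variable {α : Type u}

theorem iter_add (g : α →. α) (i s : ℕ) : iter g (i + s) = (iter g i).comp (iter g s) := by
  induction s with
  | zero => simp [iter]
  | succ s ih => rw [← add_assoc, iter, ih, iter, PFun.comp_assoc]

theorem mem_preimage_iff_of_mem {g : α →. α} {x y : α} (h : y ∈ g x) (U : Set α) :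
    x ∈ g.preimage U ↔ y ∈ U := by
  rw [PFun.mem_preimage]
  exact ⟨fun ⟨z, hz, hzx⟩ => Part.mem_unique hzx h ▸ hz, fun hy => ⟨y, hy, h⟩⟩

theorem maxSeq_antitone (g : α →. α) : Antitone (maxSeq g) := by
  refine antitone_nat_of_succ_le fun n => ?_
  induction n with
  | zero => exact Set.subset_univ _
  | succ n ih => exact PFun.preimage_mono g ih

theorem isOpen_preimage_iter [TopologicalSpace α] {g : α →. α}
    (hg : ∀ U : Set α, IsOpen U → IsOpen (g.preimage U)) (n : ℕ) {U : Set α} (hU : IsOpen U) :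
    IsOpen ((iter g n).preimage U) := by
  induction n with
  | zero =>
    convert hU
    ext x
    simp [iter]
  | succ n ih =>
    rw [iter, PFun.preimage_comp]
    exact hg _ ih

/-- The times before `n` at which the orbit of `x` lies in `Z`. -/
noncomputable def visits (g : α →. α) (Z : Set α) (n : ℕ) (x : α) : Finset ℕ :=
  open scoped Classical in {i ∈ Finset.range n | x ∈ (iter g i).preimage Z}

theorem mem_visits {g : α →. α} {Z : Set α} {n : ℕ} {x : α} {i : ℕ} :
    i ∈ visits g Z n x ↔ i < n ∧ x ∈ (iter g i).preimage Z := by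
  simp [visits]

/-- The sets of visits to `Z` before time `n` of the points at which `g ^ i` is defined for all
`i < n`. -/
noncomputable def visitSets (g : α →. α) (Z : Set α) (n : ℕ) : Finset (Finset ℕ) :=
  open scoped Classical in
  {S ∈ (Finset.range n).powerset | ∃ x ∈ ⋂ i < n, maxSeq g i, visits g Z n x = S}

theorem visits_mem_visitSets (g : α →. α) (Z : Set α) {n : ℕ} {x : α}
    (hx : x ∈ ⋂ i < n, maxSeq g i) : visits g Z n x ∈ visitSets g Z n := by
  simp only [visitSets, Finset.mem_filter, Finset.mem_powerset]
  exact ⟨fun i hi => Finset.mem_range.2 (mem_visits.1 hi).1, x, hx, rfl⟩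

/-- A finite set of times at which visits to `Z` can be prescribed arbitrarily. -/
def IsIndependent (g : α →. α) (Z : Set α) (S : Finset ℕ) : Prop :=
  ∀ T ⊆ S, ∃ x, ∀ i ∈ S, x ∈ (iter g i).Dom ∧ (x ∈ (iter g i).preimage Z ↔ i ∈ T)

theorem IsIndependent.mono {g : α →. α} {Z : Set α} (S T : Finset ℕ) (hST : S ⊆ T)
    (h : IsIndependent g Z T) : IsIndependent g Z S := fun U hU =>
  let ⟨x, hx⟩ := h U (hU.trans hST)
  ⟨x, fun i hi => hx i (hST hi)⟩

/-- A point realising a choice at the shifted times is replaced by its image under `iter g s`. -/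
theorem IsIndependent.of_map_add {g : α →. α} {Z : Set α} (s : ℕ) (S : Finset ℕ)
    (h : IsIndependent g Z (S.map (addRightEmbedding s))) : IsIndependent g Z S := by
  intro T hT
  obtain ⟨x, hx⟩ := h (T.map (addRightEmbedding s)) (Finset.map_subset_map.2 hT)
  -- For empty `S` nothing ensures that `iter g s` is defined at `x`.
  rcases S.eq_empty_or_nonempty with rfl | ⟨i₀, hi₀⟩
  · exact ⟨x, by simp⟩
  have hx' : ∀ i ∈ S, x ∈ (iter g (i + s)).Dom ∧ (x ∈ (iter g (i + s)).preimage Z ↔ i ∈ T) := by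
    intro i hi
    simpa using hx (i + s) (by simpa using hi)
  simp only [iter_add, PFun.dom_comp, PFun.preimage_comp] at hx'
  obtain ⟨y, hy⟩ := (PFun.mem_dom _ _).1 (PFun.preimage_subset_dom _ _ (hx' i₀ hi₀).1)
  simp only [mem_preimage_iff_of_mem hy] at hx'
  exact ⟨y, hx'⟩

/-- The conclusion no longer involves `n`, so one hereditary, shift-invariant property controls the
families for all `n`. -/
theorem IsIndependent.of_shatters {g : α →. α} {Z : Set α} (n : ℕ) (S : Finset ℕ)
    (h : (visitSets g Z n).Shatters S) : IsIndependent g Z S := by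
  have hSn : ∀ i ∈ S, i < n := fun i hi => by
    obtain ⟨U, hU, hSU⟩ := h.exists_superset
    simp only [visitSets, Finset.mem_filter, Finset.mem_powerset] at hU
    exact Finset.mem_range.1 (hU.1 (hSU hi))
  intro T hT
  obtain ⟨U, hU, rfl⟩ := h hT
  simp only [visitSets, Finset.mem_filter, Finset.mem_powerset] at hU
  obtain ⟨-, x, hx, rfl⟩ := hU
  refine ⟨x, fun i hi => ⟨?_, ?_⟩⟩
  · rw [← maxSeq_eq_dom_iter]
    exact Set.mem_iInter₂.1 hx i (hSn i hi)
  · simp [mem_visits, hi, hSn i hi]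

/-- On a Noetherian space, an infinite set of times has a finite subset which is not independent
for the visits to a given closed set. -/
theorem exists_not_isIndependent [TopologicalSpace α] [TopologicalSpace.NoetherianSpace α]
    {g : α →. α} (hg : ∀ U : Set α, IsOpen U → IsOpen (g.preimage U)) {Z : Set α}
    (hZ : IsClosed Z) (T : Set ℕ) (hT : T.Infinite) :
    ∃ S : Finset ℕ, (S : Set ℕ) ⊆ T ∧ ¬ IsIndependent g Z S := by
  classical
  by_contra! h
  -- A preimage of `Z` is closed only relative to the domain of the iterate, hence the closures.
  -- They decrease, so a minimal one, at `k`, equals the one at a later `t ∈ T`. A point visiting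
  -- `Z` at all times of `S` except `t` lies in `A k`, hence in `closure (A t)`; but missing `Z` at
  -- time `t` is an open condition that excludes `A t`.
  let A : ℕ → Set α := fun k => {x | ∀ i ∈ T, i ≤ k → x ∈ (iter g i).preimage Z}
  let C : ℕ → TopologicalSpace.Closeds α := fun k => ⟨closure (A k), isClosed_closure⟩
  obtain ⟨_, ⟨k, rfl⟩, hk⟩ := wellFounded_lt.has_min (Set.range C) ⟨_, 0, rfl⟩
  obtain ⟨t, htT, hkt⟩ := hT.exists_gt k
  have hAkt : closure (A k) ⊆ closure (A t) := by
    by_contra hne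
    refine hk (C t) ⟨t, rfl⟩ (lt_of_le_not_ge ?_ hne)
    exact closure_mono fun x hx i hi hik => hx i hi (hik.trans hkt.le)
  let S : Finset ℕ := {i ∈ Finset.range (t + 1) | i ∈ T}
  have hS : ∀ {i}, i ∈ S ↔ i ≤ t ∧ i ∈ T := by simp [S]
  obtain ⟨x, hx⟩ := h S (fun i hi => (hS.1 hi).2) (S.erase t) (Finset.erase_subset _ _)
  have hxA : x ∈ closure (A t) := hAkt <| subset_closure fun i hi hik =>
    (hx i (hS.2 ⟨hik.trans hkt.le, hi⟩)).2.2
      (Finset.mem_erase.2 ⟨by omega, hS.2 ⟨hik.trans hkt.le, hi⟩⟩)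
  obtain ⟨hdom, hnot⟩ := hx t (hS.2 ⟨le_rfl, htT⟩)
  simp only [Finset.mem_erase, ne_eq, not_true_eq_false, false_and, iff_false] at hnot
  obtain ⟨y, hy⟩ := (PFun.mem_dom _ _).1 hdom
  have hyZ : x ∈ (iter g t).preimage Zᶜ :=
    (mem_preimage_iff_of_mem hy _).2 fun hyZ => hnot ((mem_preimage_iff_of_mem hy _).2 hyZ)
  obtain ⟨z, hz, hzA⟩ := mem_closure_iff.1 hxA _ (isOpen_preimage_iter hg t hZ.isOpen_compl) hyZ
  obtain ⟨w, hw, hwz⟩ := (PFun.mem_preimage _ _ _).1 hz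
  exact hw ((mem_preimage_iff_of_mem hwz _).1 (hzA t htT le_rfl))

/-- The visits of the points to all members of a finite family of sets. -/
noncomputable def pattern (g : α →. α) (𝒵 : Finset (Set α)) (n : ℕ) (x : α) : 𝒵 → Finset ℕ :=
  fun Z => visits g Z n x

/-- On a Noetherian space, the number of patterns of visits to finitely many closed sets grows
subexponentially. -/
theorem eventually_encard_pattern_le [TopologicalSpace α] [TopologicalSpace.NoetherianSpace α]
    {g : α →. α} (hg : ∀ U : Set α, IsOpen U → IsOpen (g.preimage U)) (𝒵 : Finset (Set α))
    (h𝒵 : ∀ Z ∈ 𝒵, IsClosed Z) {ε : ℝ} (hε : 0 < ε) :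
    ∀ᶠ n : ℕ in Filter.atTop,
      (((pattern g 𝒵 n '' ⋂ i < n, maxSeq g i).encard : ℕ∞) : ENNReal) ≤
        ENNReal.ofReal (Real.exp (ε * n)) := by
  -- The exponent is shared among the members of `𝒵`; the `+ 1` allows `𝒵` to be empty.
  have hε' : 0 < ε / (𝒵.card + 1) := by positivity
  have hev : ∀ᶠ n : ℕ in Filter.atTop, ∀ Z ∈ 𝒵,
      ((visitSets g Z n).card : ℝ) ≤ Real.exp (ε / (𝒵.card + 1) * n) :=
    (Filter.eventually_all_finset _).2 fun Z hZ =>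
      eventually_card_le_exp (P := IsIndependent g Z) IsIndependent.mono IsIndependent.of_map_add
        (fun T hT => exists_not_isIndependent hg (h𝒵 Z hZ) T hT) (visitSets g Z)
        (fun n S hS => by
          simp only [visitSets, Finset.mem_filter, Finset.mem_powerset] at hS
          exact hS.1)
        IsIndependent.of_shatters hε'
  filter_upwards [hev] with n hn
  have hsub : pattern g 𝒵 n '' (⋂ i < n, maxSeq g i) ⊆
      (Fintype.piFinset fun Z : 𝒵 => visitSets g Z n : Finset (𝒵 → Finset ℕ)) := by
    rintro _ ⟨x, hx, rfl⟩
    exact Finset.mem_coe.2 (Fintype.mem_piFinset.2 fun Z => visits_mem_visitSets g Z hx)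
  have hcard := Set.encard_le_encard hsub
  rw [Set.encard_coe_eq_coe_finsetCard, Fintype.card_piFinset] at hcard
  have hreal : ((∏ Z : 𝒵, (visitSets g Z n).card : ℕ) : ℝ) ≤ Real.exp (ε * n) := by
    push_cast
    calc ∏ Z : 𝒵, ((visitSets g Z n).card : ℝ)
        ≤ ∏ _Z : 𝒵, Real.exp (ε / (𝒵.card + 1) * n) :=
          Finset.prod_le_prod (fun _ _ => by positivity) fun Z _ => hn Z Z.2
      _ = Real.exp (𝒵.card * (ε / (𝒵.card + 1) * n)) := by simp [Real.exp_nat_mul]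
      _ ≤ Real.exp (ε * n) := by
          rw [Real.exp_le_exp, ← mul_assoc]
          gcongr
          rw [mul_div_assoc', div_le_iff₀ (by positivity)]
          nlinarith
  calc (((pattern g 𝒵 n '' ⋂ i < n, maxSeq g i).encard : ℕ∞) : ENNReal)
      ≤ ((∏ Z : 𝒵, (visitSets g Z n).card : ℕ) : ENNReal) := by
        rw [← ENat.toENNReal_coe]
        exact ENat.toENNReal_mono hcard
    _ ≤ ENNReal.ofReal (Real.exp (ε * n)) := by
        rw [← ENNReal.ofReal_natCast]
        exact ENNReal.ofReal_le_ofReal hreal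

/-- Points with the same pattern of visits belong to the same members of `𝒵` along their orbits. -/
theorem mem_iff_of_pattern_eq {g : α →. α} {𝒵 : Finset (Set α)} {n i : ℕ} {x y a b : α}
    (h : pattern g 𝒵 n x = pattern g 𝒵 n y) (hi : i < n) (ha : a ∈ iter g i x)
    (hb : b ∈ iter g i y) : ∀ Z ∈ 𝒵, (a ∈ Z ↔ b ∈ Z) := by
  intro Z hZ
  have := Finset.ext_iff.1 (congrFun h ⟨Z, hZ⟩) i
  simpa [pattern, mem_visits, hi, mem_preimage_iff_of_mem ha, mem_preimage_iff_of_mem hb] using this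

/-- Constructible neighbourhoods of all points contain the classes of the partition generated by
finitely many closed sets. -/
theorem exists_finset_isClosed_refining {X : Type u} [TopologicalSpace X]
    [CompactSpace (WithConstructibleTopology X)] (V : X → Set X)
    (hV : ∀ x, V x ∈ @nhds X (constructibleTopology X) x) :
    ∃ 𝒵 : Finset (Set X), (∀ Z ∈ 𝒵, IsClosed Z) ∧
      ∀ y, ∃ x, ∀ z, (∀ Z ∈ 𝒵, (y ∈ Z ↔ z ∈ Z)) → z ∈ V x := by
  classical
  have hcompact : @CompactSpace X (constructibleTopology X) :=
    @Function.Surjective.compactSpace _ _ _ (constructibleTopology X) _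
      (WithTopology.continuous_ofTopology _) _ (WithTopology.ofTopology_surjective _)
  have hbasis : ∀ x, ∃ B : Set (Set X), B.Finite ∧ B ⊆ constructibleTopologySubbasis X ∧
      x ∈ ⋂₀ B ∧ ⋂₀ B ⊆ V x := by
    intro x
    have hb := @TopologicalSpace.isTopologicalBasis_of_subbasis X (constructibleTopology X)
      (constructibleTopologySubbasis X) rfl
    obtain ⟨_, ⟨B, ⟨hBfin, hB⟩, rfl⟩, hxB, hBV⟩ :=
      (@TopologicalSpace.IsTopologicalBasis.mem_nhds_iff X (constructibleTopology X) _ _ _ hb).1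
        (hV x)
    exact ⟨B, hBfin, hB, hxB, hBV⟩
  choose B hBfin hB hxB hBV using hbasis
  obtain ⟨t, -, ht⟩ := @IsCompact.elim_nhds_subcover X (constructibleTopology X) _
    (@isCompact_univ X (constructibleTopology X) hcompact) (fun x => ⋂₀ B x) (fun x _ =>
      @IsOpen.mem_nhds X (constructibleTopology X) _ _
        (@Set.Finite.isOpen_sInter X (constructibleTopology X) _ (hBfin x) fun s hs =>
          TopologicalSpace.isOpen_generateFrom_of_mem (hB x hs)) (hxB x))
  let 𝒮 : Finset (Set X) := t.biUnion fun x => (hBfin x).toFinset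
  -- Each subbasic set is open or closed in the given topology, so it or its complement survives the
  -- filter, and this decides membership in it.
  refine ⟨(𝒮 ∪ 𝒮.image compl).filter IsClosed, fun Z hZ => (Finset.mem_filter.1 hZ).2, fun y => ?_⟩
  obtain ⟨x, hxt, hyx⟩ := Set.mem_iUnion₂.1 (ht (Set.mem_univ y))
  refine ⟨x, fun z hz => hBV x fun s hs => ?_⟩
  have hs𝒮 : s ∈ 𝒮 := Finset.mem_biUnion.2 ⟨x, hxt, (hBfin x).mem_toFinset.2 hs⟩
  have hys : y ∈ s := hyx s hs
  rcases hB x hs with ⟨hopen, -⟩ | ⟨hclosed, -⟩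
  · have := hz sᶜ (Finset.mem_filter.2 ⟨Finset.mem_union_right _
      (Finset.mem_image_of_mem _ hs𝒮), hopen.isClosed_compl⟩)
    simpa [hys] using this
  · exact (hz s (Finset.mem_filter.2 ⟨Finset.mem_union_left _ hs𝒮, hclosed⟩)).1 hys

/-! ### Bounds for the entropies -/

theorem expGrowthSup_nonpos {u : ℕ → ENNReal}
    (h : ∀ ε : ℝ, 0 < ε → ∀ᶠ n : ℕ in Filter.atTop, u n ≤ ENNReal.ofReal (Real.exp (ε * n))) :
    ExpGrowth.expGrowthSup u ≤ 0 := by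
  rw [ExpGrowth.expGrowthSup_le_iff]
  intro b hb
  obtain ⟨ε, hε, hεb⟩ := EReal.lt_iff_exists_real_btwn.1 hb
  filter_upwards [h ε (by exact_mod_cast hε)] with n hn
  refine hn.trans ?_
  rw [← EReal.exp_coe, EReal.exp_le_exp_iff]
  push_cast
  gcongr

theorem expGrowthSup_nonneg {u : ℕ → ENNReal} (h : ∀ n, 1 ≤ u n) :
    0 ≤ ExpGrowth.expGrowthSup u := by
  rw [← ExpGrowth.expGrowthSup_const one_ne_zero ENNReal.one_ne_top]
  exact ExpGrowth.expGrowthSup_monotone h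

theorem one_le_coveringNumber {g : α →. α} {n : ℕ} (h : (maxSeq g n).Nonempty) (E : Set (α × α)) :
    1 ≤ coveringNumber g n E := by
  refine le_iInf₂ fun F _ => le_iInf fun hF => ?_
  obtain ⟨x, hx⟩ := h
  obtain ⟨y, hy, -⟩ := Set.mem_iUnion₂.1 (hF hx)
  exact Set.one_le_encard_iff_nonempty.2 ⟨y, hy⟩

theorem one_le_coverComplexity {g : α →. α} {n : ℕ} (h : (maxSeq g n).Nonempty)
    (𝒰 : Set (Set α)) : 1 ≤ coverComplexity g 𝒰 n := by
  refine le_iInf₂ fun T _ => le_iInf fun hT => ?_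
  obtain ⟨x, hx⟩ := h
  obtain ⟨W, hW, -⟩ := hT (Set.mem_iInter₂.2 fun i hi => maxSeq_antitone g hi.le hx)
  exact Set.one_le_encard_iff_nonempty.2 ⟨W, hW⟩

theorem entourageEntropy_nonneg (τ : TopologicalSpace α) {g : α →. α}
    (h : ∀ n, (maxSeq g n).Nonempty) : 0 ≤ entourageEntropy τ g := by
  refine le_iSup₂_of_le Set.univ ⟨Filter.univ_mem, rfl⟩ (expGrowthSup_nonneg fun n => ?_)
  exact_mod_cast one_le_coveringNumber (h n) _

theorem openCoverEntropy_nonneg (τ : TopologicalSpace α) {g : α →. α}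
    (h : ∀ n, (maxSeq g n).Nonempty) : 0 ≤ openCoverEntropy τ g := by
  refine le_iSup₂_of_le {Set.univ} ⟨Set.finite_singleton _, by simp, by simp⟩
    (expGrowthSup_nonneg fun n => ?_)
  exact_mod_cast one_le_coverComplexity (h n) _

theorem openCoverEntropy_anti {σ τ : TopologicalSpace α} (h : σ ≤ τ) (g : α →. α) :
    openCoverEntropy τ g ≤ openCoverEntropy σ g :=
  iSup₂_le fun 𝒰 h𝒰 => le_iSup₂_of_le 𝒰
    ⟨h𝒰.finite, fun U hU => h U (h𝒰.isOpen U hU), h𝒰.covers⟩ le_rfl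

theorem IsSymmEntourage.exists_mem_nhds {τ : TopologicalSpace α} {E : Set (α × α)}
    (hE : IsSymmEntourage τ E) (x : α) : ∃ V ∈ nhds x, V ×ˢ V ⊆ E := by
  have h : E ∈ nhds (x, x) := mem_nhdsSet_iff_forall.1 hE.1 (x, x) rfl
  rwa [nhds_prod_eq, Filter.mem_prod_same_iff] at h

/-- If points with the same position relative to `𝒵` are `E`-close, the covering numbers for `E`
are bounded by the numbers of patterns of visits to the members of `𝒵`. -/
theorem coveringNumber_le_encard_pattern (g : α →. α) {E : Set (α × α)} {𝒵 : Finset (Set α)}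
    (h : ∀ a b, (∀ Z ∈ 𝒵, (a ∈ Z ↔ b ∈ Z)) → (a, b) ∈ E) (n : ℕ) :
    coveringNumber g n E ≤ (pattern g 𝒵 (n + 1) '' ⋂ i < n + 1, maxSeq g i).encard := by
  -- `F` contains one point for each pattern. Patterns run to `n + 1` because dynamical balls
  -- include time `n`.
  obtain ⟨F, hFA, hF⟩ := Set.exists_subset_bijOn (⋂ i < n + 1, maxSeq g i) (pattern g 𝒵 (n + 1))
  rw [← hF.image_eq, hF.injOn.encard_image]
  have hsub : F ⊆ maxSeq g n := fun x hx => Set.mem_iInter₂.1 (hFA hx) n n.lt_succ_self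
  refine iInf₂_le_of_le F hsub (iInf_le_of_le (fun y hy => ?_) le_rfl)
  have hyA : y ∈ ⋂ i < n + 1, maxSeq g i :=
    Set.mem_iInter₂.2 fun i hi => maxSeq_antitone g (Nat.lt_succ_iff.1 hi) hy
  obtain ⟨x, hxF, hxy⟩ := hF.surjOn (Set.mem_image_of_mem _ hyA)
  refine Set.mem_iUnion₂.2 ⟨x, hxF, hy, fun i hi => ?_⟩
  have hdom : ∀ z ∈ maxSeq g n, ∃ a, a ∈ iter g i z := fun z hz => by
    have := maxSeq_antitone g hi hz
    rwa [maxSeq_eq_dom_iter, PFun.mem_dom] at this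
  obtain ⟨a, ha⟩ := hdom x (hsub hxF)
  obtain ⟨b, hb⟩ := hdom y hy
  exact ⟨a, ha, b, hb, h a b (mem_iff_of_pattern_eq hxy (Nat.lt_succ_iff.2 hi) ha hb)⟩

/-- If the classes of the partition generated by `𝒵` are contained in members of `𝒰`, the
complexities of the joins of `𝒰` are bounded by the numbers of patterns of visits to the members
of `𝒵`. -/
theorem coverComplexity_le_encard_pattern (g : α →. α) {𝒰 : Set (Set α)} {𝒵 : Finset (Set α)}
    (h : ∀ a, ∃ U ∈ 𝒰, ∀ b, (∀ Z ∈ 𝒵, (a ∈ Z ↔ b ∈ Z)) → b ∈ U) (n : ℕ) :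
    coverComplexity g 𝒰 n ≤ (pattern g 𝒵 n '' ⋂ i < n, maxSeq g i).encard := by
  classical
  obtain ⟨F, hFA, hF⟩ := Set.exists_subset_bijOn (⋂ i < n, maxSeq g i) (pattern g 𝒵 n)
  rw [← hF.image_eq, hF.injOn.encard_image]
  have hdom : ∀ z ∈ ⋂ i < n, maxSeq g i, ∀ i < n, ∃ a, a ∈ iter g i z := fun z hz i hi => by
    have := Set.mem_iInter₂.1 hz i hi
    rwa [maxSeq_eq_dom_iter, PFun.mem_dom] at this
  choose V hV𝒰 hV using h
  have hU : ∀ x ∈ F, ∃ U : ℕ → Set α, ∀ i < n, U i ∈ 𝒰 ∧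
      ∀ a ∈ iter g i x, ∀ b, (∀ Z ∈ 𝒵, (a ∈ Z ↔ b ∈ Z)) → b ∈ U i := by
    intro x hx
    have : ∀ i, ∃ U, i < n → U ∈ 𝒰 ∧
        ∀ a ∈ iter g i x, ∀ b, (∀ Z ∈ 𝒵, (a ∈ Z ↔ b ∈ Z)) → b ∈ U := by
      intro i
      by_cases hi : i < n
      · obtain ⟨a, ha⟩ := hdom x (hFA hx) i hi
        exact ⟨V a, fun _ => ⟨hV𝒰 a, fun a' ha' => Part.mem_unique ha ha' ▸ hV a⟩⟩
      -- The value at times from `n` on is irrelevant.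
      · exact ⟨∅, fun h => absurd h hi⟩
    choose U hU using this
    exact ⟨U, hU⟩
  choose! U hU using hU
  refine iInf₂_le_of_le ((fun x => ⋂ i < n, (iter g i).preimage (U x i)) '' F) ?_
    (iInf_le_of_le (fun y hy => ?_) (Set.encard_image_le _ _))
  · rintro _ ⟨x, hx, rfl⟩
    exact ⟨U x, fun i hi => (hU x hx i hi).1, rfl⟩
  · obtain ⟨x, hxF, hxy⟩ := hF.surjOn (Set.mem_image_of_mem _ hy)
    refine ⟨_, ⟨x, hxF, rfl⟩, Set.mem_iInter₂.2 fun i hi => ?_⟩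
    obtain ⟨a, ha⟩ := hdom x (hFA hxF) i hi
    obtain ⟨b, hb⟩ := hdom y hy i hi
    exact ⟨b, (hU x hxF i hi).2 a ha b (mem_iff_of_pattern_eq hxy hi ha hb), hb⟩

/-! ### Upper bounds on Noetherian spaces -/

section Noetherian

variable {X : Type u} [TopologicalSpace X] [TopologicalSpace.NoetherianSpace X]

theorem constructibleTopology_le : constructibleTopology X ≤ ‹TopologicalSpace X› := fun U hU =>
  IsCompact.isOpen_constructibleTopology_of_isOpen
    (TopologicalSpace.NoetherianSpace.isCompact U) hU

variable [CompactSpace (WithConstructibleTopology X)] {g : X →. X}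

theorem entourageEntropy_constructibleTopology_nonpos
    (hg : ∀ U : Set X, IsOpen U → IsOpen (g.preimage U)) :
    entourageEntropy (constructibleTopology X) g ≤ 0 := by
  refine iSup₂_le fun E hE => expGrowthSup_nonpos fun ε hε => ?_
  choose V hV hVE using hE.exists_mem_nhds
  obtain ⟨𝒵, h𝒵, h⟩ := exists_finset_isClosed_refining V hV
  have hclose : ∀ a b, (∀ Z ∈ 𝒵, (a ∈ Z ↔ b ∈ Z)) → (a, b) ∈ E := fun a b hab => by
    obtain ⟨x, hx⟩ := h a
    exact hVE x ⟨hx a fun _ _ => Iff.rfl, hx b hab⟩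
  -- Halving `ε` absorbs the extra time step: `ε / 2 * (n + 1) ≤ ε * n` once `n ≥ 1`.
  have hev := (Filter.tendsto_add_atTop_nat 1).eventually
    (eventually_encard_pattern_le hg 𝒵 h𝒵 (half_pos hε))
  filter_upwards [hev, Filter.eventually_ge_atTop 1] with n hn hn1
  refine (ENat.toENNReal_mono (coveringNumber_le_encard_pattern g hclose n)).trans (hn.trans ?_)
  refine ENNReal.ofReal_le_ofReal (Real.exp_le_exp.2 ?_)
  have : (1 : ℝ) ≤ n := by exact_mod_cast hn1
  push_cast
  nlinarith

theorem openCoverEntropy_constructibleTopology_nonpos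
    (hg : ∀ U : Set X, IsOpen U → IsOpen (g.preimage U)) :
    openCoverEntropy (constructibleTopology X) g ≤ 0 := by
  refine iSup₂_le fun 𝒰 h𝒰 => expGrowthSup_nonpos fun ε hε => ?_
  have hcov : ∀ x, ∃ U ∈ 𝒰, x ∈ U := fun x => Set.mem_sUnion.1 (h𝒰.covers ▸ Set.mem_univ x)
  choose V hV hxV using hcov
  obtain ⟨𝒵, h𝒵, h⟩ := exists_finset_isClosed_refining V fun x =>
    @IsOpen.mem_nhds X (constructibleTopology X) _ _ (h𝒰.isOpen _ (hV x)) (hxV x)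
  filter_upwards [eventually_encard_pattern_le hg 𝒵 h𝒵 hε] with n hn
  refine (ENat.toENNReal_mono (coverComplexity_le_encard_pattern g (fun a => ?_) n)).trans hn
  obtain ⟨x, hx⟩ := h a
  exact ⟨V x, hV x, hx⟩

end Noetherian

end PartialDynamics

/-! ### Point maps of dominant rational self-maps -/

namespace RationalDynamics

variable {X : Scheme.{u}} {f : X ⤏ X} {g : X →. X}

theorem hom_mem_of_eq_pointMap {φ : X.PartialMap X} (hφ : ∀ y ∈ φ.domain, g y = pointMap φ y)
    (x : X) (hx : x ∈ φ.domain) : φ.hom ⟨x, hx⟩ ∈ g x := by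
  rw [hφ x hx]
  exact ⟨hx, rfl⟩

/-- Openness is local, and near each point of its domain `g` is a morphism on an open subscheme. -/
theorem Induces.isOpen_preimage (hg : Induces f g) {U : Set X} (hU : IsOpen U) :
    IsOpen (g.preimage U) := by
  rw [isOpen_iff_forall_mem_open]
  rintro x ⟨y, hyU, hyx⟩
  obtain ⟨φ, -, hxφ, hφ⟩ := hg.2 x ((PFun.mem_dom _ _).2 ⟨y, hyx⟩)
  refine ⟨Subtype.val '' (φ.hom ⁻¹' U), ?_, ?_, ?_⟩
  · rintro _ ⟨z, hz, rfl⟩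
    exact ⟨φ.hom z, hz, hom_mem_of_eq_pointMap hφ z.1 z.2⟩
  · exact φ.domain.2.isOpenMap_subtype_val _ (hU.preimage φ.hom.continuous)
  · have hyx' : y ∈ g x := hyx
    rw [hφ x hxφ] at hyx'
    obtain ⟨_, rfl⟩ := hyx'
    exact ⟨⟨x, hxφ⟩, hyU, rfl⟩

theorem Induces.nonempty_preimage [Nonempty X] [f.IsDominant] (hg : Induces f g) {U : Set X}
    (hU : IsOpen U) (hne : U.Nonempty) : (g.preimage U).Nonempty := by
  obtain ⟨x, hx⟩ := hg.1.nonempty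
  obtain ⟨φ, rfl, -, hφ⟩ := hg.2 x hx
  have : IsDominant φ.hom := φ.isDominant_toRationalMap_iff.1 inferInstance
  obtain ⟨_, hyU, z, rfl⟩ := φ.hom.denseRange.inter_open_nonempty U hU hne
  exact ⟨z.1, φ.hom z, hyU, hom_mem_of_eq_pointMap hφ z.1 z.2⟩

/-- Dominance enters here: pulling back keeps open sets nonempty, so the entropies are not `⊥`. -/
theorem Induces.nonempty_maxSeq [Nonempty X] [f.IsDominant] (hg : Induces f g) (n : ℕ) :
    (PartialDynamics.maxSeq g n).Nonempty := by
  suffices IsOpen (PartialDynamics.maxSeq g n) ∧ (PartialDynamics.maxSeq g n).Nonempty from this.2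
  induction n with
  | zero => exact ⟨isOpen_univ, Set.univ_nonempty⟩
  | succ n ih => exact ⟨hg.isOpen_preimage ih.1, hg.nonempty_preimage ih.1 ih.2⟩

end RationalDynamics

/-- A dominant rational self-map of a nonempty Noetherian scheme has zero topological entropy for
the constructible topology (through entourages and through open covers) and for the Zariski
topology (through open covers). -/
theorem theorem3 (X : Scheme.{u}) [IsNoetherian X] [Nonempty X] (f : X ⤏ X) [f.IsDominant]
    (g : X →. X) (hg : RationalDynamics.Induces f g) :
    PartialDynamics.entourageEntropy (constructibleTopology X) g = 0 ∧
      PartialDynamics.openCoverEntropy (constructibleTopology X) g = 0 ∧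
      PartialDynamics.openCoverEntropy (zariskiTopology X) g = 0 := by
  have hcont : ∀ U : Set X, IsOpen U → IsOpen (g.preimage U) := fun _ hU => hg.isOpen_preimage hU
  have hne := hg.nonempty_maxSeq
  have hcov := PartialDynamics.openCoverEntropy_constructibleTopology_nonpos hcont
  refine ⟨le_antisymm (PartialDynamics.entourageEntropy_constructibleTopology_nonpos hcont)
    (PartialDynamics.entourageEntropy_nonneg _ hne),
    le_antisymm hcov (PartialDynamics.openCoverEntropy_nonneg _ hne),
    le_antisymm ?_ (PartialDynamics.openCoverEntropy_nonneg _ hne)⟩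
  exact (PartialDynamics.openCoverEntropy_anti PartialDynamics.constructibleTopology_le g).trans
    hcov
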